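/- All graphs are finite, simple and undirected. For a graph $G$ and a nonempty set $S$ of vertices of $G$, let $\delta_G(S)$ be the minimum degree in $G$ of the vertices of $S$. For a graph $G$ with at least one vertex, let $$f(G)=\max\{\,|I|-\delta_G(I)+1 \;:\; I \text{ a nonempty independent set of } G\,\},$$ and let $f(G)=0$ if $G$ has no vertices. A pseudo 2-factor of $G$ is a spanning subgraph of $G$ each of whose connected components is isomorphic to $K_1$, $K_2$ or a cycle (of length at least $3$); a component of it is called a non-cycle component if it is isomorphic to $K_1$ or $K_2$. Theorem. Every graph $G$ has a pseudo 2-factor with at most $\max\{0,f(G)\}$ non-cycle components. -/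

import Mathlib

namespace SimpleGraph

variable {V : Type*}

/-- A component `c` of `H` is a non-cycle component if it is isomorphic to `K_1` or `K_2`. -/
def IsNonCycleComponent (H : SimpleGraph V) (c : H.ConnectedComponent) : Prop :=
  Nonempty (c.toSimpleGraph ≃g completeGraph (Fin 1)) ∨
    Nonempty (c.toSimpleGraph ≃g completeGraph (Fin 2))

/-- A component `c` of `H` is a cycle if it is isomorphic to `C_n` for some `n ≥ 3`. -/
def IsCycleComponent (H : SimpleGraph V) (c : H.ConnectedComponent) : Prop :=
  ∃ n : ℕ, 3 ≤ n ∧ Nonempty (c.toSimpleGraph ≃g cycleGraph n)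

/-- `H` is a pseudo 2-factor of `G`: a spanning subgraph of `G` (a graph on the same vertex set
whose edges are edges of `G`) each component of which is a `K_1`, a `K_2` or a cycle. -/
def IsPseudoTwoFactor (G H : SimpleGraph V) : Prop :=
  H ≤ G ∧ ∀ c : H.ConnectedComponent, H.IsNonCycleComponent c ∨ H.IsCycleComponent c

/-- The number of non-cycle components of `H`. -/
noncomputable def numNonCycleComponents (H : SimpleGraph V) : ℕ :=
  {c : H.ConnectedComponent | H.IsNonCycleComponent c}.ncard

section

variable [Fintype V] (G : SimpleGraph V) [DecidableRel G.Adj]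

/-- `δ_G(S)`: the minimum degree in `G` of the vertices of the nonempty set `S`. -/
def minDegreeOn (S : Finset V) (hS : S.Nonempty) : ℕ :=
  S.inf' hS fun v => G.degree v

/-- The integers `|I| - δ_G(I) + 1`, for `I` a nonempty independent set of `G`. -/
def indepExcessSet : Set ℤ :=
  {z | ∃ (I : Finset V) (hI : I.Nonempty), G.IsIndepSet (I : Set V) ∧
    z = (I.card : ℤ) - (G.minDegreeOn I hI : ℤ) + 1}

/-- `f(G)`: the maximum of `|I| - δ_G(I) + 1` over the nonempty independent sets `I` of `G`.
It is attained whenever `G` has a vertex, see `isGreatest_indepExcess`; for the graph without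
vertices, which has no such `I`, its value is `0`. -/
noncomputable def indepExcess : ℤ :=
  sSup G.indepExcessSet

theorem isGreatest_indepExcess [Nonempty V] :
    IsGreatest G.indepExcessSet G.indepExcess := by
  have hne : G.indepExcessSet.Nonempty := by
    obtain ⟨v⟩ := ‹Nonempty V›
    exact ⟨_, {v}, Finset.singleton_nonempty v, by simp [IsIndepSet], rfl⟩
  have hbdd : BddAbove G.indepExcessSet := by
    refine ⟨(Fintype.card V : ℤ) + 1, ?_⟩
    rintro z ⟨I, hI, -, rfl⟩
    have := Finset.card_le_univ I
    omega
  exact ⟨Int.csSup_mem hne hbdd, fun z hz => le_csSup hbdd hz⟩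

end

end SimpleGraph

namespace SimpleGraph

variable {V : Type*} {G : SimpleGraph V}

/-! A pseudo 2-factor is encoded as a permutation moving vertices along edges; a set `R` meeting
every orbit of length at most 2 bounds the number of non-cycle components.

Suppose the vertices cannot be partitioned into cycles. Take disjoint cycles with vertex set `W` and
a nonempty path `Q` avoiding them, covering as many vertices as possible, with `Q` shortest. Let `v`
be the first vertex of `Q` and `N` the set of its neighbours in `W`. Maximality and minimality
confine the neighbours of `v` to `N` and the second vertex of `Q`, so `deg v ≤ |N| + 1`. Rerouting
the cycles through `N` shows that the successors `σ(N)` on the cycles are independent and have no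
neighbours outside `W`.

Let `K` be the first two vertices of `Q` (only `v` if there is no second). By
`exists_isIndepSet_hasPartialFactor`, the complement of `W ∪ K` contains an independent `I` and
splits into cycles and at most `|I|` vertices and edges. Adding `K` gives at most `|I| + 1`
non-cycle components. The set `{v} ∪ σ(N) ∪ I` is independent, has at least `deg v + |I|` elements
and contains `v`, so `f(G) ≥ |I| + 1`. -/

/-- The permutation `σ` moves only vertices of `A`, moves them along edges of `G`, and the set `R`
meets all orbits of `σ` in `A` with at most two elements. -/
structure IsPartialFactor (G : SimpleGraph V) (σ : Equiv.Perm V) (R A : Finset V) : Prop where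
  fix : ∀ x, x ∉ A → σ x = x
  adj : ∀ x ∈ A, σ x = x ∨ G.Adj x (σ x)
  short : ∀ x ∈ A, σ (σ x) = x → x ∈ R ∨ σ x ∈ R

/-- The vertices of `A` can be partitioned into cycles of `G` and at most `n` vertices and edges. -/
def HasPartialFactor (G : SimpleGraph V) (A : Finset V) (n : ℕ) : Prop :=
  ∃ (σ : Equiv.Perm V) (R : Finset V), R.card ≤ n ∧ G.IsPartialFactor σ R A

/-- `l` lists the vertices of a path whose ends coincide or are adjacent. -/
structure IsClosedList (G : SimpleGraph V) (l : List V) : Prop where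
  nodup : l.Nodup
  chain : l.IsChain G.Adj
  closed : ∀ a ∈ l.head?, ∀ b ∈ l.getLast?, a = b ∨ G.Adj b a

/-! ### Combining partial factors -/

lemma IsPartialFactor.apply_mem {σ : Equiv.Perm V} {R A : Finset V}
    (h : G.IsPartialFactor σ R A) {x : V} (hx : x ∈ A) : σ x ∈ A := by
  by_contra hn
  have h1 := h.fix _ hn
  rw [σ.injective h1] at hn
  exact hn hx

lemma HasPartialFactor.mono {A : Finset V} {m n : ℕ} (h : G.HasPartialFactor A m) (hmn : m ≤ n) :
    G.HasPartialFactor A n := by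
  obtain ⟨σ, R, hR, h⟩ := h
  exact ⟨σ, R, hR.trans hmn, h⟩

lemma hasPartialFactor_empty : G.HasPartialFactor ∅ 0 :=
  ⟨1, ∅, le_rfl, ⟨fun _ _ => rfl, by simp, by simp⟩⟩

lemma HasPartialFactor.union [DecidableEq V] {A B : Finset V} {m n : ℕ}
    (hA : G.HasPartialFactor A m) (hB : G.HasPartialFactor B n) (hAB : Disjoint A B) :
    G.HasPartialFactor (A ∪ B) (m + n) := by
  obtain ⟨σ, R, hR, hσ⟩ := hA
  obtain ⟨τ, S, hS, hτ⟩ := hB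
  have h1 : ∀ x ∈ A, (σ * τ) x = σ x := fun x hx => by
    rw [Equiv.Perm.mul_apply, hτ.fix x (Finset.disjoint_left.1 hAB hx)]
  have h2 : ∀ x ∈ B, (σ * τ) x = τ x := fun x hx => by
    rw [Equiv.Perm.mul_apply, hσ.fix _ (Finset.disjoint_right.1 hAB (hτ.apply_mem hx))]
  refine ⟨σ * τ, R ∪ S, (Finset.card_union_le _ _).trans (add_le_add hR hS), ⟨?_, ?_, ?_⟩⟩
  · intro x hx
    rw [Finset.mem_union, not_or] at hx
    rw [Equiv.Perm.mul_apply, hτ.fix x hx.2, hσ.fix x hx.1]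
  · intro x hx
    rcases Finset.mem_union.1 hx with hx | hx
    · rw [h1 x hx]; exact hσ.adj x hx
    · rw [h2 x hx]; exact hτ.adj x hx
  · intro x hx
    rcases Finset.mem_union.1 hx with hx | hx
    · rw [h1 x hx, h1 _ (hσ.apply_mem hx)]
      intro h
      simpa only [Finset.mem_union] using (hσ.short x hx h).imp Or.inl Or.inl
    · rw [h2 x hx, h2 _ (hτ.apply_mem hx)]
      intro h
      simpa only [Finset.mem_union] using (hτ.short x hx h).imp Or.inr Or.inr

lemma IsClosedList.isPartialFactor [DecidableEq V] {l : List V} (h : G.IsClosedList l)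
    {R : Finset V} (hR : l.length ≤ 2 → ∀ x ∈ l, x ∈ R ∨ l.formPerm x ∈ R) :
    G.IsPartialFactor l.formPerm R l.toFinset := by
  refine ⟨fun x hx => List.formPerm_apply_of_notMem (by simpa using hx), ?_, ?_⟩
  · intro x hx
    obtain ⟨i, hi, rfl⟩ := List.getElem_of_mem (List.mem_toFinset.1 hx)
    rw [List.formPerm_apply_getElem _ h.nodup]
    by_cases hi' : i + 1 < l.length
    · right
      simp only [Nat.mod_eq_of_lt hi']
      exact h.chain.getElem i hi'
    · have hl : i + 1 = l.length := by omega
      simp only [hl, Nat.mod_self]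
      refine h.closed _ ?_ _ ?_
      · simp [List.head?_eq_getElem?, List.getElem?_eq_getElem (show 0 < l.length by omega)]
      · have : l.length - 1 = i := by omega
        simp [List.getLast?_eq_getElem?, this]
  · intro x hx hxx
    refine hR ?_ x (List.mem_toFinset.1 hx)
    obtain ⟨i, hi, rfl⟩ := List.getElem_of_mem (List.mem_toFinset.1 hx)
    -- The square of `formPerm` shifts indices by 2 modulo the length, so it has no fixed point on a
    -- list of length at least 3.
    have h2 := List.formPerm_pow_apply_getElem l h.nodup 2 i hi
    rw [pow_two, Equiv.Perm.mul_apply, hxx, h.nodup.getElem_inj_iff] at h2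
    by_contra hlen
    push Not at hlen
    by_cases h3 : i + 2 < l.length
    · rw [Nat.mod_eq_of_lt h3] at h2; omega
    · rw [Nat.mod_eq_sub_mod (by omega), Nat.mod_eq_of_lt (by omega)] at h2; omega

lemma IsClosedList.hasPartialFactor_zero [DecidableEq V] {l : List V} (h : G.IsClosedList l)
    (hl : 3 ≤ l.length) : G.HasPartialFactor l.toFinset 0 :=
  ⟨_, ∅, le_rfl, h.isPartialFactor fun h' => by omega⟩

lemma IsClosedList.hasPartialFactor_one [DecidableEq V] {l : List V} (h : G.IsClosedList l) :
    G.HasPartialFactor l.toFinset 1 := by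
  match l, h with
  | [], _ => exact hasPartialFactor_empty.mono zero_le_one
  | a :: l, h =>
    refine ⟨_, {a}, by simp, h.isPartialFactor ?_⟩
    intro hl x hx
    match l, hl with
    | [], _ => simpa using hx
    | [b], _ =>
      rw [List.formPerm_pair]
      rcases List.mem_pair.1 hx with rfl | rfl <;> simp

/-! ### Greedy partition by longest paths -/

/-- Every set `A` of vertices contains an independent set `I` such that `A` can be partitioned
into cycles and at most `|I|` vertices and edges. -/
lemma exists_isIndepSet_hasPartialFactor [Fintype V] [DecidableEq V] (A : Finset V) :
    ∃ I ⊆ A, G.IsIndepSet (I : Set V) ∧ G.HasPartialFactor A I.card := by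
  classical
  induction hn : A.card using Nat.strong_induction_on generalizing A with
  | _ n ih =>
  subst hn
  rcases A.eq_empty_or_nonempty with rfl | ⟨w, hw⟩
  · exact ⟨∅, subset_rfl, by simp [IsIndepSet], hasPartialFactor_empty⟩
  -- `Q` will be a longest path in `A`; all neighbours in `A` of its first vertex `v` then lie on
  -- it.
  let P : ℕ → Prop := fun m => ∃ Q : List V, Q.Nodup ∧ Q.IsChain G.Adj ∧ (∀ x ∈ Q, x ∈ A) ∧
    Q.length = m
  have hP1 : P 1 := ⟨[w], by simp, by simp, by simpa using hw, rfl⟩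
  have hPle : ∀ m, P m → m ≤ A.card := by
    rintro m ⟨Q, h1, -, h2, rfl⟩
    rw [← List.toFinset_card_of_nodup h1]
    exact Finset.card_le_card fun x hx => h2 x (List.mem_toFinset.1 hx)
  obtain ⟨Q, hQ1, hQ2, hQ3, hQ4⟩ : P (Nat.findGreatest P A.card) :=
    Nat.findGreatest_spec (hPle 1 hP1) hP1
  have hmax : ∀ m, P m → m ≤ Q.length := fun m hm => by
    rw [hQ4]; exact Nat.le_findGreatest (hPle m hm) hm
  match Q, hQ1, hQ2, hQ3, hmax with
  | [], _, _, _, hmax => simpa using hmax 1 hP1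
  | v :: q, hQ1, hQ2, hQ3, hmax =>
  have hv : v ∈ A := hQ3 v (by simp)
  have hnbr : ∀ x ∈ A, G.Adj v x → x ∈ q := by
    intro x hx hvx
    by_contra hxq
    have := hmax (q.length + 2) ⟨x :: v :: q, ?_, ?_, ?_, rfl⟩
    · simp at this
    · rw [List.nodup_cons]
      exact ⟨by simp [hxq, hvx.ne'], hQ1⟩
    · exact List.IsChain.cons_cons hvx.symm hQ2
    · intro y hy
      rcases List.mem_cons.1 hy with rfl | hy
      · exact hx
      · exact hQ3 y hy
  -- Cut the path at the last neighbour of `v`. This prefix closes up to a single component, and `v`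
  -- has no neighbour in the rest of `A`, so `v` can join the independent set found there.
  obtain ⟨l, hl, hlA, hvl, hln⟩ : ∃ l : List V, G.IsClosedList l ∧ (∀ x ∈ l, x ∈ A) ∧ v ∈ l ∧
      ∀ x ∈ A, G.Adj v x → x ∈ l := by
    let p : ℕ → Prop := fun j => ∃ h : j < (v :: q).length, G.Adj v (v :: q)[j]
    by_cases hp : ∃ j, p j
    · obtain ⟨j, hj⟩ := hp
      set k := Nat.findGreatest p q.length with hk
      have hjq : j ≤ q.length := by have := hj.1; simp at this; omega
      obtain ⟨hkl, hkv⟩ : p k := Nat.findGreatest_spec hjq hj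
      have hhead : ((v :: q).take (k + 1)).head? = some v := by simp
      refine ⟨(v :: q).take (k + 1), ⟨hQ1.sublist (List.take_sublist _ _), hQ2.take _, ?_⟩,
        fun x hx => hQ3 x (List.mem_of_mem_take hx), by simp, ?_⟩
      · intro a ha b hb
        rw [hhead] at ha
        right
        have hb' : b = (v :: q)[k] := by
          rw [List.getLast?_eq_getElem?, List.length_take, min_eq_left (by omega)] at hb
          rw [List.getElem?_take_of_lt (by omega)] at hb
          simp only [Nat.add_sub_cancel] at hb
          rw [List.getElem?_eq_getElem hkl] at hb
          simpa [eq_comm] using hb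
        rw [hb', ← Option.mem_some.1 ha]
        exact hkv.symm
      · intro x hx hvx
        obtain ⟨i, hi, hix⟩ := List.getElem_of_mem (List.mem_cons_of_mem v (hnbr x hx hvx))
        have hik : i ≤ k := Nat.le_findGreatest (by simp at hi; omega) ⟨hi, by rwa [hix]⟩
        rw [List.mem_take_iff_getElem]
        exact ⟨i, by omega, hix⟩
    · refine ⟨[v], ⟨by simp, by simp, by simp⟩, by simpa using hv, by simp, ?_⟩
      intro x hx hvx
      obtain ⟨i, hi, hix⟩ := List.getElem_of_mem (List.mem_cons_of_mem v (hnbr x hx hvx))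
      exact absurd ⟨i, hi, by rwa [hix]⟩ hp
  have hlA' : l.toFinset ⊆ A := fun x hx => hlA x (List.mem_toFinset.1 hx)
  obtain ⟨I, hIA, hI, hF⟩ := ih (A \ l.toFinset).card
    (Finset.card_lt_card (Finset.sdiff_ssubset hlA' ⟨v, by simpa using hvl⟩)) (A \ l.toFinset) rfl
  have hvI : ∀ x ∈ I, ¬ G.Adj v x := fun x hx hvx => by
    have := Finset.mem_sdiff.1 (hIA hx)
    exact this.2 (List.mem_toFinset.2 (hln x this.1 hvx))
  have hvI' : v ∉ I := fun h => (Finset.mem_sdiff.1 (hIA h)).2 (List.mem_toFinset.2 hvl)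
  refine ⟨insert v I, ?_, ?_, ?_⟩
  · exact Finset.insert_subset hv (hIA.trans Finset.sdiff_subset)
  · rw [Finset.coe_insert]
    exact hI.insert fun x hx _ => ⟨hvI x hx, fun h => hvI x hx h.symm⟩
  · rw [Finset.card_insert_of_notMem hvI']
    have := hF.union hl.hasPartialFactor_one Finset.sdiff_disjoint
    rwa [Finset.sdiff_union_of_subset hlA'] at this
-- Opening the cycles of a cycle cover
lemma IsPartialFactor.apply_apply_ne {σ : Equiv.Perm V} {W : Finset V}
    (h : G.IsPartialFactor σ ∅ W) {x : V} (hx : x ∈ W) : σ (σ x) ≠ x := fun hxx => by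
  simpa using h.short x hx hxx

lemma IsPartialFactor.apply_ne {σ : Equiv.Perm V} {W : Finset V}
    (h : G.IsPartialFactor σ ∅ W) {x : V} (hx : x ∈ W) : σ x ≠ x := fun hxx =>
  h.apply_apply_ne hx (by rw [hxx, hxx])

lemma IsPartialFactor.adj_apply {σ : Equiv.Perm V} {W : Finset V}
    (h : G.IsPartialFactor σ ∅ W) {x : V} (hx : x ∈ W) : G.Adj x (σ x) :=
  (h.adj x hx).resolve_left (h.apply_ne hx)

lemma IsPartialFactor.restrict {σ : Equiv.Perm V} {W A : Finset V}
    (h : G.IsPartialFactor σ ∅ W) (hAW : A ⊆ W) (hA : ∀ x, σ x ∈ A ↔ x ∈ A) :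
    ∃ τ : Equiv.Perm V, G.IsPartialFactor τ ∅ A ∧ ∀ x ∈ A, τ x = σ x := by
  classical
  set τ : Equiv.Perm V := Equiv.Perm.ofSubtype (σ.subtypePerm (p := (· ∈ A)) hA) with hτ
  have h1 : ∀ x ∈ A, τ x = σ x := fun x hx => by
    rw [hτ, Equiv.Perm.ofSubtype_apply_of_mem _ hx]; rfl
  refine ⟨τ, ⟨fun x hx => Equiv.Perm.ofSubtype_apply_of_not_mem _ hx, ?_, ?_⟩, h1⟩
  · intro x hx
    rw [h1 x hx]; exact h.adj x (hAW hx)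
  · intro x hx
    rw [h1 x hx, h1 _ ((hA x).2 hx)]
    exact h.short x (hAW hx)

/-- The cycle through `x`, listed from the successor of `x` up to `x`. -/
lemma IsPartialFactor.exists_orbit_list [Fintype V] [DecidableEq V] {σ : Equiv.Perm V}
    {W : Finset V} (h : G.IsPartialFactor σ ∅ W) {x : V} (hx : x ∈ W) :
    ∃ l : List V, l.Nodup ∧ 3 ≤ l.length ∧ l.IsChain G.Adj ∧ l.IsChain (fun a b => b = σ a) ∧
      l.head? = some (σ x) ∧ l.getLast? = some x ∧ l.toFinset ⊆ W ∧
      ∃ τ : Equiv.Perm V, G.IsPartialFactor τ ∅ (W \ l.toFinset) ∧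
        ∀ y ∈ W \ l.toFinset, τ y = σ y := by
  have hσx := h.apply_mem hx
  have hsupp : σ x ∈ σ.support := Equiv.Perm.mem_support.2 (h.apply_ne hσx)
  set l := σ.toList (σ x) with hl
  have hmem : ∀ y, y ∈ l ↔ σ.SameCycle (σ x) y := fun y => by
    rw [hl, Equiv.Perm.mem_toList_iff]; exact and_iff_left hsupp
  have hnd : l.Nodup := Equiv.Perm.nodup_toList _ _
  have hget : ∀ i (hi : i < l.length), l[i] = (σ ^ i) (σ x) := fun i hi =>
    Equiv.Perm.getElem_toList _ _ _ _
  have hpos : 0 < l.length := Equiv.Perm.length_toList_pos_of_mem_support _ _ hsupp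
  have hstep : ∀ y, σ y ∈ l ↔ y ∈ l := fun y => by
    rw [hmem, hmem, Equiv.Perm.sameCycle_apply_right]
  have hxl : x ∈ l := by
    rw [hmem]
    exact Equiv.Perm.sameCycle_apply_left.2 (Equiv.Perm.SameCycle.refl _ _)
  have hlW : ∀ y ∈ l, y ∈ W := by
    intro y hy
    by_contra hyW
    exact hyW (((hmem y).1 hy).symm.eq_of_left (h.fix y hyW) ▸ hσx)
  have hsucc : ∀ i (hi : i + 1 < l.length), l[i + 1] = σ l[i] := fun i hi => by
    rw [hget, hget, pow_succ', Equiv.Perm.mul_apply]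
  obtain ⟨k, hk, hkx⟩ := List.getElem_of_mem hxl
  -- `x` is the last entry: otherwise the next one would be `σ x`, which is already the entry at
  -- index 0.
  have hkl : k + 1 = l.length := by
    by_contra hne
    have hk' : k + 1 < l.length := by omega
    have h1 := hsucc k hk'
    have h0 : l[0] = σ x := by rw [hget 0 hpos]; rfl
    rw [hkx, ← h0, hnd.getElem_inj_iff] at h1
    omega
  refine ⟨l, hnd, ?_, ?_, ?_, ?_, ?_, fun y hy => hlW y (List.mem_toFinset.1 hy), ?_⟩
  · rw [← List.toFinset_card_of_nodup hnd]
    have hsub : ({x, σ x, σ (σ x)} : Finset V) ⊆ l.toFinset := by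
      intro y
      simp only [Finset.mem_insert, Finset.mem_singleton, List.mem_toFinset]
      rintro (rfl | rfl | rfl)
      · exact hxl
      · rwa [hstep]
      · rwa [hstep, hstep]
    refine le_trans (le_of_eq ?_) (Finset.card_le_card hsub)
    rw [Finset.card_eq_three.2]
    exact ⟨_, _, _, (h.apply_ne hx).symm, (h.apply_apply_ne hx).symm, (h.apply_ne hσx).symm, rfl⟩
  · rw [List.isChain_iff_getElem]
    intro i hi
    rw [hsucc i hi]
    exact h.adj_apply (hlW _ (List.getElem_mem _))
  · rw [List.isChain_iff_getElem]
    exact hsucc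
  · rw [List.head?_eq_getElem?, List.getElem?_eq_getElem hpos, hget 0 hpos]; rfl
  · have : l.length - 1 = k := by omega
    rw [List.getLast?_eq_getElem?, this, List.getElem?_eq_getElem hk, hkx]
  · refine h.restrict Finset.sdiff_subset fun y => ?_
    have hW : σ y ∈ W ↔ y ∈ W := by
      refine ⟨fun hy => ?_, h.apply_mem⟩
      by_contra hn
      exact hn (h.fix y hn ▸ hy)
    simp only [Finset.mem_sdiff, List.mem_toFinset, hstep, hW]

/-- Deleting the edges of a cycle cover leaving two vertices `x` and `y` along the orientation,
the cycles through `x` and `y` fall apart into two paths that start in the successors of `x` and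
`y` and end in `x` and `y` in some order. -/
lemma IsPartialFactor.exists_two_lists [Fintype V] [DecidableEq V] {σ : Equiv.Perm V}
    {W : Finset V} (h : G.IsPartialFactor σ ∅ W) {x y : V} (hx : x ∈ W) (hy : y ∈ W)
    (hxy : x ≠ y) :
    ∃ a b : List V, (a ++ b).Nodup ∧ a.IsChain G.Adj ∧ b.IsChain G.Adj ∧
      a.head? = some (σ x) ∧ b.head? = some (σ y) ∧
      (∀ z ∈ a.getLast?, z = x ∨ z = y) ∧ (∀ z ∈ b.getLast?, z = x ∨ z = y) ∧
      (a ++ b).toFinset ⊆ W ∧ G.HasPartialFactor (W \ (a ++ b).toFinset) 0 := by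
  obtain ⟨l, hnd, -, hch, hσ, hhead, hlast, hlW, τ, hτ, hτσ⟩ := h.exists_orbit_list hx
  -- If `x` and `y` share a cycle, cutting after `y` gives paths from `σ x` to `y` and from `σ y` to
  -- `x`; otherwise each cycle is opened separately.
  by_cases hyl : y ∈ l
  · obtain ⟨a, b, rfl⟩ := List.append_of_mem hyl
    match b with
    | [] =>
      simp only [List.getLast?_concat, Option.some.injEq] at hlast
      exact absurd hlast.symm hxy
    | z :: b =>
      have hz : z = σ y := by
        rw [List.isChain_append_cons_cons] at hσ
        exact hσ.2.1
      subst hz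
      have hl : a ++ y :: σ y :: b = (a ++ [y]) ++ σ y :: b := by simp
      rw [hl] at hnd hlW hτ
      refine ⟨a ++ [y], σ y :: b, hnd, ?_, ?_, ?_, rfl, ?_, ?_, hlW, τ, ∅, le_rfl, hτ⟩
      · rw [hl] at hch; exact hch.left_of_append
      · rw [hl] at hch; exact hch.right_of_append
      · rw [← hhead]; cases a <;> simp
      · intro z hz; right; simpa [eq_comm] using hz
      · intro z hz; left
        rw [hl, List.getLast?_append_of_ne_nil _ (by simp), hz] at hlast
        exact Option.some.inj hlast
  · have hy' : y ∈ W \ l.toFinset := by simp [hy, hyl]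
    obtain ⟨m, hnd', -, hch', -, hhead', hlast', hmW, ρ, hρ, -⟩ := hτ.exists_orbit_list hy'
    rw [hτσ y hy'] at hhead'
    have hm : ∀ z ∈ m, z ∈ W ∧ z ∉ l := fun z hz => by
      simpa using hmW (List.mem_toFinset.2 hz)
    refine ⟨l, m, ?_, hch, hch', hhead, hhead', ?_, ?_, ?_, ρ, ∅, le_rfl, ?_⟩
    · exact hnd.append hnd' fun z hz hz' => (hm z hz').2 hz
    · intro z hz; left; rw [hlast] at hz; exact (Option.some.inj hz).symm
    · intro z hz; right; rw [hlast'] at hz; exact (Option.some.inj hz).symm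
    · rw [List.toFinset_append]
      exact Finset.union_subset hlW (hmW.trans Finset.sdiff_subset)
    · rwa [List.toFinset_append, ← Finset.sup_eq_union, ← sdiff_sdiff_left]
-- From permutations to spanning subgraphs
/-- The graph whose edges join the vertices to their images under `σ`. -/
def permGraph (σ : Equiv.Perm V) : SimpleGraph V where
  Adj u v := u ≠ v ∧ (σ u = v ∨ σ v = u)
  symm := ⟨fun _ _ h => ⟨h.1.symm, h.2.symm⟩⟩
  loopless := ⟨fun _ h => h.1 rfl⟩

lemma reachable_permGraph_apply (σ : Equiv.Perm V) (v : V) :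
    (permGraph σ).Reachable v (σ v) := by
  by_cases h : v = σ v
  · rw [← h]
  · exact Adj.reachable ⟨h, Or.inl rfl⟩

lemma reachable_permGraph_iff [Finite V] (σ : Equiv.Perm V) (u v : V) :
    (permGraph σ).Reachable u v ↔ σ.SameCycle u v := by
  constructor
  · rintro ⟨p⟩
    induction p with
    | nil => exact Equiv.Perm.SameCycle.refl _ _
    | cons h _ ih =>
      refine Equiv.Perm.SameCycle.trans ?_ ih
      rcases h.2 with rfl | rfl
      · exact Equiv.Perm.sameCycle_apply_right.2 (Equiv.Perm.SameCycle.refl _ _)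
      · exact Equiv.Perm.sameCycle_apply_left.2 (Equiv.Perm.SameCycle.refl _ _)
  · intro h
    obtain ⟨n, -, rfl⟩ := h.exists_pow_eq'
    induction n with
    | zero => rfl
    | succ n ih =>
      rw [pow_succ', Equiv.Perm.mul_apply]
      exact (ih ⟨n, by simp⟩).trans (reachable_permGraph_apply _ _)

/-- `hinj` and `hmod` hold when `n` is the minimal period of `v`; on the orbit, `f` then acts as `i
↦ i + 1` modulo `n`. -/
lemma iterate_adj_iff_cycleGraph_adj {f : V → V} {v : V} {n : ℕ}
    (hinj : ∀ i j : Fin n, f^[i] v = f^[j] v ↔ i = j) (hmod : ∀ m, f^[m % n] v = f^[m] v)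
    (i j : Fin n) :
    (f^[i] v ≠ f^[j] v ∧ (f (f^[i] v) = f^[j] v ∨ f (f^[j] v) = f^[i] v)) ↔
      (cycleGraph n).Adj i j := by
  rw [ne_eq, hinj]
  match n with
  | 0 => exact i.elim0
  | 1 => simp [Subsingleton.elim i j]
  | k + 2 =>
    have hstep : ∀ i : Fin (k + 2), f (f^[i] v) = f^[(i + 1 : Fin (k + 2))] v := fun i => by
      rw [← Function.iterate_succ_apply' f, Fin.val_add, Fin.val_one, hmod]
    rw [hstep, hstep, hinj, hinj, cycleGraph_adj, sub_eq_iff_eq_add', sub_eq_iff_eq_add',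
      and_iff_right_of_imp, or_comm, eq_comm, @eq_comm _ (i + 1)]
    rintro (h | h) rfl <;> simp at h

/-- The component of `v` in `permGraph σ` is a cycle graph, where `cycleGraph 1` and
`cycleGraph 2` are complete. -/
lemma nonempty_iso_cycleGraph [Finite V] (σ : Equiv.Perm V) (v : V) :
    ∃ n, 1 ≤ n ∧ Nonempty
      (((permGraph σ).connectedComponentMk v).toSimpleGraph ≃g cycleGraph n) := by
  set n := Function.minimalPeriod σ v with hn
  have hpos : 0 < n := Function.minimalPeriod_pos_of_mem_periodicPts
    (σ.injective.mem_periodicPts v)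
  set c := (permGraph σ).connectedComponentMk v with hc
  have hmem : ∀ u, u ∈ c.supp ↔ σ.SameCycle v u := fun u => by
    rw [ConnectedComponent.mem_supp_iff, hc, ConnectedComponent.eq, reachable_permGraph_iff,
      Equiv.Perm.sameCycle_comm]
  have hinj : ∀ i j : Fin n, σ^[i] v = σ^[j] v ↔ i = j := fun i j => by
    rw [Function.iterate_eq_iterate_iff_of_lt_minimalPeriod i.2 j.2, Fin.ext_iff]
  let g : Fin n → c := fun i => ⟨σ^[i] v, (hmem _).2 ⟨i, by simp [Equiv.Perm.iterate_eq_pow]⟩⟩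
  have hg : Function.Bijective g := by
    constructor
    · intro i j hij
      exact (hinj i j).1 (congrArg Subtype.val hij)
    · rintro ⟨u, hu⟩
      obtain ⟨m, -, rfl⟩ := ((hmem u).1 hu).exists_pow_eq'
      refine ⟨⟨m % n, Nat.mod_lt _ hpos⟩, Subtype.ext ?_⟩
      change σ^[m % n] v = _
      rw [hn, Function.iterate_mod_minimalPeriod_eq, Equiv.Perm.iterate_eq_pow]
  have hadj : ∀ i j, c.toSimpleGraph.Adj (g i) (g j) ↔ (cycleGraph n).Adj i j := by
    intro i j
    have h1 : c.toSimpleGraph.Adj (g i) (g j) ↔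
        σ^[i] v ≠ σ^[j] v ∧ (σ (σ^[i] v) = σ^[j] v ∨ σ (σ^[j] v) = σ^[i] v) := Iff.rfl
    rw [h1]
    exact iterate_adj_iff_cycleGraph_adj hinj
      (fun m => by rw [hn, Function.iterate_mod_minimalPeriod_eq]) i j
  exact ⟨n, hpos, ⟨RelIso.symm ⟨Equiv.ofBijective g hg, fun {i j} => hadj i j⟩⟩⟩

/-- Components of `permGraph σ` are orbits of `σ`. A non-cycle component has at most two vertices,
so it meets `R`, and `R` maps onto a set containing all of these components. -/
lemma HasPartialFactor.exists_isPseudoTwoFactor [Fintype V] {n : ℕ}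
    (h : G.HasPartialFactor Finset.univ n) :
    ∃ H : SimpleGraph V, G.IsPseudoTwoFactor H ∧ H.numNonCycleComponents ≤ n := by
  classical
  obtain ⟨σ, R, hR, hσ⟩ := h
  refine ⟨permGraph σ, ⟨?_, ?_⟩, ?_⟩
  · rintro u v ⟨huv, rfl | rfl⟩
    · exact (hσ.adj u (Finset.mem_univ _)).resolve_left huv.symm
    · exact ((hσ.adj v (Finset.mem_univ _)).resolve_left huv).symm
  · intro c
    induction c using ConnectedComponent.ind with | _ v =>
    obtain ⟨m, hm, ⟨e⟩⟩ := nonempty_iso_cycleGraph σ v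
    match m with
    | 1 => exact Or.inl (Or.inl ⟨by rw [cycleGraph_one_eq_top] at e; exact e⟩)
    | 2 => exact Or.inl (Or.inr ⟨by rw [cycleGraph_two_eq_top] at e; exact e⟩)
    | m + 3 => exact Or.inr ⟨m + 3, by omega, ⟨e⟩⟩
  · refine le_trans ?_ hR
    rw [numNonCycleComponents, ← Set.ncard_coe_finset R]
    refine le_trans (Set.ncard_le_ncard (t := (permGraph σ).connectedComponentMk '' R) ?_
      (Set.toFinite _)) (Set.ncard_image_le (Set.toFinite _))
    intro c hc
    induction c using ConnectedComponent.ind with | _ v =>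
    have hcard : Nat.card ((permGraph σ).connectedComponentMk v) ≤ 2 := by
      rcases hc with ⟨⟨e⟩⟩ | ⟨⟨e⟩⟩
      · rw [Nat.card_congr e.toEquiv]; simp
      · rw [Nat.card_congr e.toEquiv]; simp
    have h1 : (permGraph σ).connectedComponentMk (σ v) = (permGraph σ).connectedComponentMk v :=
      ConnectedComponent.eq.2 (reachable_permGraph_apply σ v).symm
    have h2 : (permGraph σ).connectedComponentMk (σ (σ v)) =
        (permGraph σ).connectedComponentMk v :=
      (ConnectedComponent.eq.2 (reachable_permGraph_apply σ (σ v)).symm).trans h1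
    have h3 : σ (σ v) = v := by
      by_contra hne
      have hne1 : σ v ≠ v := fun h => hne (by rw [h, h])
      have hsub : (({v, σ v, σ (σ v)} : Finset V) : Set V) ⊆
          ((permGraph σ).connectedComponentMk v).supp := by
        intro y
        simp only [Finset.coe_insert, Finset.coe_singleton, Set.mem_insert_iff,
          Set.mem_singleton_iff, ConnectedComponent.mem_supp_iff]
        rintro (rfl | rfl | rfl)
        exacts [rfl, h1, h2]
      have h4 := Set.ncard_le_ncard hsub (Set.toFinite _)
      rw [Set.ncard_coe_finset, Finset.card_eq_three.2 ⟨_, _, _, hne1.symm, Ne.symm hne,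
        fun h => hne1 (σ.injective h).symm, rfl⟩] at h4
      exact absurd (h4.trans hcard) (by norm_num)
    rcases hσ.short v (Finset.mem_univ _) h3 with h4 | h4
    · exact ⟨v, h4, rfl⟩
    · exact ⟨σ v, h4, h1⟩
-- Extremal cycles and path
/-- `W` can be partitioned into cycles and `Q` is a path avoiding `W`. -/
structure IsCyclesPath (G : SimpleGraph V) (W : Finset V) (Q : List V) : Prop where
  cycles : G.HasPartialFactor W 0
  nodup : Q.Nodup
  chain : Q.IsChain G.Adj
  disjoint : ∀ x ∈ Q, x ∉ W

/-- If the vertices cannot be partitioned into cycles, there are a nonempty path and disjoint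
cycles that cover as many vertices as possible and whose path is as short as possible. -/
lemma exists_extremal_isCyclesPath [Fintype V] [DecidableEq V]
    (h0 : ¬ G.HasPartialFactor Finset.univ 0) :
    ∃ W Q, G.IsCyclesPath W Q ∧ Q ≠ [] ∧
      (∀ W' Q', G.IsCyclesPath W' Q' → Q' ≠ [] →
        (W' ∪ Q'.toFinset).card ≤ (W ∪ Q.toFinset).card) ∧
      ∀ W' Q', G.IsCyclesPath W' Q' →
        (W ∪ Q.toFinset).card ≤ (W' ∪ Q'.toFinset).card → Q.length ≤ Q'.length := by
  classical
  obtain ⟨w, -⟩ : (Finset.univ : Finset V).Nonempty := by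
    rw [Finset.nonempty_iff_ne_empty]
    intro h
    exact h0 (h ▸ hasPartialFactor_empty)
  let P : ℕ → Prop := fun m => ∃ W Q, G.IsCyclesPath W Q ∧ Q ≠ [] ∧ (W ∪ Q.toFinset).card = m
  have hP1 : P (∅ ∪ [w].toFinset).card :=
    ⟨∅, [w], ⟨hasPartialFactor_empty, by simp, by simp, by simp⟩, by simp, rfl⟩
  have hPle : ∀ m, P m → m ≤ Fintype.card V := by
    rintro m ⟨W, Q, -, -, rfl⟩
    exact Finset.card_le_univ _
  set S := Nat.findGreatest P (Fintype.card V) with hS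
  have hPS : P S := Nat.findGreatest_spec (hPle _ hP1) hP1
  have hmax : ∀ m, P m → m ≤ S := fun m hm => Nat.le_findGreatest (hPle m hm) hm
  have hR : ∃ k W Q, G.IsCyclesPath W Q ∧ Q ≠ [] ∧ (W ∪ Q.toFinset).card = S ∧ Q.length = k := by
    obtain ⟨W, Q, h1, h2, h3⟩ := hPS
    exact ⟨_, W, Q, h1, h2, h3, rfl⟩
  obtain ⟨W, Q, h1, h2, h3, h4⟩ := Nat.find_spec hR
  refine ⟨W, Q, h1, h2, fun W' Q' h h' => h3 ▸ hmax _ ⟨W', Q', h, h', rfl⟩, ?_⟩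
  intro W' Q' h hle
  rw [h3] at hle
  -- An empty path is never optimal, since an uncovered vertex could be added as a path. So the
  -- minimality clause needs no `Q' ≠ []`, and a path may later be absorbed entirely.
  have hne : Q' ≠ [] := by
    rintro rfl
    obtain ⟨u, hu⟩ : ∃ u, u ∉ W' := by
      by_contra hall
      push Not at hall
      exact h0 (Finset.eq_univ_of_forall hall ▸ h.cycles)
    have := hmax _ ⟨W', [u], ⟨h.cycles, by simp, by simp, by simpa using hu⟩, by simp, rfl⟩
    rw [Finset.card_union_of_disjoint (by simpa using hu)] at this
    simp at this hle
    omega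
  rw [h4]
  exact Nat.find_min' hR ⟨W', Q', h, hne, le_antisymm (hmax _ ⟨W', Q', h, hne, rfl⟩) hle, rfl⟩

/-- If the vertices cannot be partitioned into cycles, there are a number `n` and an independent
set with at least `n + d` elements, one of which has degree `d`, such that the vertices can be
partitioned into cycles and at most `n + 1` vertices and edges. -/
theorem exists_isIndepSet_degree_add_le [Fintype V] [DecidableEq V] [DecidableRel G.Adj]
    (h0 : ¬ G.HasPartialFactor Finset.univ 0) :
    ∃ (n : ℕ) (I : Finset V) (v : V), v ∈ I ∧ G.IsIndepSet (I : Set V) ∧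
      G.degree v + n ≤ I.card ∧ G.HasPartialFactor Finset.univ (n + 1) := by
  obtain ⟨W, Q, hWQ, hQne, hmax, hmin⟩ := exists_extremal_isCyclesPath h0
  -- Contradiction to maximal coverage: the cycles on `B` are opened, and a new path covers them,
  -- `Q` and a new vertex `w`.
  have hgrow : ∀ (B Q' : List V) (w : V), w ∉ W → w ∉ Q →
      G.HasPartialFactor (W \ B.toFinset) 0 → Q'.Nodup → Q'.IsChain G.Adj →
      (∀ x, x ∈ Q' ↔ x = w ∨ x ∈ B ∧ x ∈ W ∨ x ∈ Q) → False := by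
    intro B Q' w hwW hwQ hB hnd hch hmem
    have h1 := hmax (W \ B.toFinset) Q' ⟨hB, hnd, hch, ?_⟩ ?_
    · have h2 : insert w (W ∪ Q.toFinset) ⊆ W \ B.toFinset ∪ Q'.toFinset := by
        intro x
        simp only [Finset.mem_insert, Finset.mem_union, List.mem_toFinset, Finset.mem_sdiff, hmem]
        tauto
      have h3 := Finset.card_le_card h2
      rw [Finset.card_insert_of_notMem (by simp [hwW, hwQ])] at h3
      omega
    · intro x hx
      rw [Finset.mem_sdiff, List.mem_toFinset]
      rcases (hmem x).1 hx with rfl | h | h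
      · exact fun h => hwW h.1
      · exact fun h' => h'.2 h.1
      · exact fun h' => hWQ.disjoint x h h'.1
    · rintro rfl
      simpa using (hmem w).2 (Or.inl rfl)
  -- Contradiction to minimal path length: an initial part `a` of `Q` and the opened cycles on `B`
  -- form one cycle `c`, with unchanged coverage.
  have hmove : ∀ (B a b c : List V), Q = a ++ b → a ≠ [] → B.toFinset ⊆ W →
      G.HasPartialFactor (W \ B.toFinset) 0 → G.IsClosedList c → 3 ≤ c.length →
      (∀ x, x ∈ c ↔ x ∈ B ∨ x ∈ a) → False := by
    rintro B a b c rfl ha hBW hB hc hc3 hmem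
    have haW : ∀ x ∈ a, x ∉ W := fun x hx => hWQ.disjoint x (List.mem_append_left _ hx)
    have hW' : W \ B.toFinset ∪ c.toFinset = W ∪ a.toFinset := by
      ext x
      have := @hBW x
      simp only [Finset.mem_union, List.mem_toFinset, Finset.mem_sdiff, hmem] at this ⊢
      tauto
    have h1 := hmin (W ∪ a.toFinset) b ⟨?_, hWQ.nodup.of_append_right, hWQ.chain.right_of_append,
      ?_⟩ ?_
    · have := List.length_pos_iff.2 ha
      rw [List.length_append] at h1
      omega
    · rw [← hW']
      refine hB.union (hc.hasPartialFactor_zero hc3) ?_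
      rw [Finset.disjoint_right]
      intro x hx
      rw [List.mem_toFinset, hmem] at hx
      rw [Finset.mem_sdiff, List.mem_toFinset]
      rcases hx with hx | hx
      · exact fun h => h.2 hx
      · exact fun h => haW x hx h.1
    · intro x hx
      rw [Finset.mem_union, List.mem_toFinset, not_or]
      exact ⟨hWQ.disjoint x (List.mem_append_right _ hx),
        fun hxa => List.disjoint_of_nodup_append hWQ.nodup hxa hx⟩
    · rw [List.toFinset_append, Finset.union_assoc]
  match Q, hQne with
  | v :: q, _ =>
  obtain ⟨σ, R, hR, hσ⟩ := id hWQ.cycles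
  obtain rfl : R = ∅ := Finset.card_eq_zero.1 (Nat.le_zero.1 hR)
  have hvW : v ∉ W := hWQ.disjoint v (by simp)
  have hout : ∀ w, G.Adj v w → w ∈ W ∨ w ∈ q := by
    intro w hvw
    by_contra hw
    rw [not_or] at hw
    have hwQ : w ∉ v :: q := by simp [hvw.ne', hw.2]
    exact hgrow [] (w :: v :: q) w hw.1 hwQ (by simpa using hWQ.cycles)
      (List.nodup_cons.2 ⟨hwQ, hWQ.nodup⟩) (List.IsChain.cons_cons hvw.symm hWQ.chain) (by simp)
  have hhead : ∀ p ∈ q, G.Adj v p → q.head? = some p := by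
    intro p hp hvp
    obtain ⟨a, b, rfl⟩ := List.append_of_mem hp
    match a with
    | [] => rfl
    | x :: a =>
      exfalso
      have hQ : v :: (x :: a ++ p :: b) = (v :: x :: a ++ [p]) ++ b := by simp
      refine hmove [] (v :: x :: a ++ [p]) b (v :: x :: a ++ [p]) hQ (by simp) (by simp)
        (by simpa using hWQ.cycles) ⟨?_, ?_, ?_⟩ (by simp) (by simp)
      · have := hWQ.nodup; rw [hQ] at this; exact this.of_append_left
      · have := hWQ.chain; rw [hQ] at this; exact this.left_of_append
      · intro y hy z hz
        rw [List.getLast?_concat, Option.mem_some_iff] at hz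
        simp only [List.cons_append, List.head?_cons, Option.mem_some_iff] at hy
        subst hy hz
        exact Or.inr hvp.symm
  have hsucc_out : ∀ x ∈ W, G.Adj v x → ∀ w, w ∉ W → w ∉ v :: q → ¬ G.Adj (σ x) w := by
    intro x hx hvx w hwW hwQ hxw
    obtain ⟨l, hnd, -, hch, -, hlh, hll, hlW, τ, hτ, -⟩ := hσ.exists_orbit_list hx
    have hlW' : ∀ y ∈ l, y ∈ W := fun y hy => hlW (List.mem_toFinset.2 hy)
    -- The longer path enters the cycle from `w` at `σ x`, runs around to `x` and continues along
    -- `Q` from `v`.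
    refine hgrow l (w :: (l ++ v :: q)) w hwW hwQ ⟨τ, ∅, le_rfl, hτ⟩ ?_ ?_ ?_
    · rw [List.nodup_cons]
      refine ⟨?_, hnd.append hWQ.nodup fun y hy hy' => hWQ.disjoint y hy' (hlW' y hy)⟩
      rw [List.mem_append, not_or]
      exact ⟨fun h => hwW (hlW' w h), hwQ⟩
    · rw [List.isChain_cons, List.isChain_append]
      refine ⟨?_, hch, hWQ.chain, ?_⟩
      · simpa [List.head?_append, hlh] using hxw.symm
      · simpa [hll] using hvx.symm
    · intro y
      have := hlW' y
      simp only [List.mem_cons, List.mem_append]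
      tauto
  have hsucc_path : ∀ x ∈ W, G.Adj v x → ∀ p ∈ v :: q, ¬ G.Adj (σ x) p := by
    intro x hx hvx p hp hxp
    obtain ⟨l, hnd, hl3, hch, -, hlh, hll, hlW, τ, hτ, -⟩ := hσ.exists_orbit_list hx
    have hlW' : ∀ y ∈ l, y ∈ W := fun y hy => hlW (List.mem_toFinset.2 hy)
    obtain ⟨a, b, hab⟩ := List.append_of_mem hp
    have hQ : v :: q = (a ++ [p]) ++ b := by simp [hab]
    have hah : (a ++ [p]).head? = some v := by
      have := congrArg List.head? hQ
      rw [List.head?_append_of_ne_nil _ (by simp)] at this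
      exact this.symm
    have hnd' := hWQ.nodup
    have hch' := hWQ.chain
    rw [hQ] at hnd' hch'
    -- The new cycle runs from `σ x` around to `x`, then along `Q` from `v` to `p`, and back to `σ
    -- x`.
    refine hmove l (a ++ [p]) b (l ++ (a ++ [p])) hQ (by simp) hlW ⟨τ, ∅, le_rfl, hτ⟩
      ⟨?_, ?_, ?_⟩ (by simp; omega) (by simp)
    · refine hnd.append hnd'.of_append_left fun y hy hy' => ?_
      exact hWQ.disjoint y (hQ ▸ List.mem_append_left _ hy') (hlW' y hy)
    · rw [List.isChain_append]
      refine ⟨hch, hch'.left_of_append, ?_⟩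
      simpa [hll, hah] using hvx.symm
    · intro y hy z hz
      right
      rw [← List.append_assoc, List.getLast?_concat, Option.mem_some_iff] at hz
      rw [List.head?_append, hlh] at hy
      simp only [Option.some_or, Option.mem_some_iff] at hy
      subst hy hz
      exact hxp.symm
  have hsucc_succ : ∀ x ∈ W, ∀ y ∈ W, x ≠ y → G.Adj v x → G.Adj v y →
      ¬ G.Adj (σ x) (σ y) := by
    intro x hx y hy hxy hvx hvy hadj
    obtain ⟨a, b, hnd, ha, hb, hah, hbh, hal, hbl, habW, hF⟩ := hσ.exists_two_lists hx hy hxy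
    have hlast : ∀ z, z = x ∨ z = y → G.Adj v z := by rintro z (rfl | rfl) <;> assumption
    have habW' : ∀ z, z ∈ a ∨ z ∈ b → z ∈ W := fun z hz =>
      habW (List.mem_toFinset.2 (List.mem_append.2 hz))
    have hane : a ≠ [] := by rintro rfl; simp at hah
    have hbne : b ≠ [] := by rintro rfl; simp at hbh
    -- The new cycle goes from `v` backwards along `a`, crosses the edge between `σ x` and `σ y`,
    -- follows `b` and returns to `v`; both paths end in neighbours of `v`.
    refine hmove (a ++ b) [v] q (v :: (a.reverse ++ b)) rfl (by simp) habW hF ⟨?_, ?_, ?_⟩ ?_ ?_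
    · rw [List.nodup_cons, List.mem_append, List.mem_reverse]
      refine ⟨fun h => hvW (habW' v h), ?_⟩
      rw [List.nodup_append'] at hnd ⊢
      exact ⟨List.nodup_reverse.2 hnd.1, hnd.2.1, List.disjoint_reverse_left.2 hnd.2.2⟩
    · rw [List.isChain_cons, List.isChain_append, List.isChain_reverse]
      refine ⟨?_, ha.imp fun _ _ h => h.symm, hb, ?_⟩
      · rw [List.head?_append_of_ne_nil _ (by simpa using hane), List.head?_reverse]
        exact fun z hz => hlast z (hal z hz)
      · simpa [List.getLast?_reverse, hah, hbh] using hadj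
    · intro z hz u hu
      rw [← List.cons_append, List.getLast?_append_of_ne_nil _ hbne] at hu
      simp only [List.head?_cons, Option.mem_some_iff] at hz
      subst hz
      exact Or.inr (hlast u (hbl u hu)).symm
    · have := List.length_pos_iff.2 hane
      have := List.length_pos_iff.2 hbne
      simp; omega
    · intro z
      simp only [List.mem_cons, List.mem_append, List.mem_reverse, List.not_mem_nil]
      tauto
  set K : List V := (v :: q).take 2 with hK
  have hKsub : ∀ x ∈ K, x ∈ v :: q := fun x hx => List.mem_of_mem_take hx
  have hKF : G.HasPartialFactor K.toFinset 1 := by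
    refine IsClosedList.hasPartialFactor_one
      ⟨hWQ.nodup.sublist (List.take_sublist _ _), hWQ.chain.take _, ?_⟩
    have hch := hWQ.chain
    rw [hK]
    match q, hch with
    | [], _ => simp
    | p :: q, hch =>
      rw [List.isChain_cons_cons] at hch
      simpa using Or.inr hch.1.symm
  obtain ⟨I, hIU, hI, hIF⟩ := exists_isIndepSet_hasPartialFactor (G := G) (W ∪ K.toFinset)ᶜ
  have hIU' : ∀ x ∈ I, x ∉ W ∧ x ∉ K := fun x hx => by simpa using hIU hx
  set N : Finset V := W.filter (G.Adj v) with hN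
  have hNmem : ∀ x ∈ N, x ∈ W ∧ G.Adj v x := fun x hx => Finset.mem_filter.1 hx
  -- The extra 1 is the second vertex of `Q`, the only possible neighbour of `v` outside `W`.
  have hdeg : G.degree v ≤ N.card + 1 := by
    rw [← G.card_neighborFinset_eq_degree]
    have hsub : G.neighborFinset v ⊆ N ∪ q.head?.toFinset := by
      intro x hx
      rw [mem_neighborFinset] at hx
      rw [Finset.mem_union, hN, Finset.mem_filter, Option.mem_toFinset]
      exact (hout x hx).imp (fun h => ⟨h, hx⟩) fun h => hhead x h hx
    refine (Finset.card_le_card hsub).trans ((Finset.card_union_le _ _).trans ?_)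
    have : q.head?.toFinset.card ≤ 1 := by cases q.head? <;> simp
    omega
  have hNσ : ∀ x ∈ N.image σ, x ∈ W := by
    intro x hx
    obtain ⟨y, hy, rfl⟩ := Finset.mem_image.1 hx
    exact hσ.apply_mem (hNmem y hy).1
  refine ⟨I.card, insert v (N.image σ ∪ I), v, Finset.mem_insert_self _ _, ?_, ?_, ?_⟩
  · rw [Finset.coe_insert, Finset.coe_union]
    have hvI : ∀ x ∈ I, ¬ G.Adj v x := by
      intro x hx hvx
      have hxq := (hout x hvx).resolve_left (hIU' x hx).1
      have hxh := hhead x hxq hvx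
      refine (hIU' x hx).2 ?_
      cases q with
      | nil => simp at hxh
      | cons p q => simp at hxh; simp [hK, hxh]
    have hvS : ∀ x ∈ N.image σ, ¬ G.Adj v x := by
      intro x hx hvx
      obtain ⟨y, hy, rfl⟩ := Finset.mem_image.1 hx
      exact hsucc_path y (hNmem y hy).1 (hNmem y hy).2 v (by simp) hvx.symm
    have hSI : ∀ x ∈ N.image σ, ∀ y ∈ I, ¬ G.Adj x y := by
      intro x hx y hy
      obtain ⟨x, hxN, rfl⟩ := Finset.mem_image.1 hx
      by_cases hyQ : y ∈ v :: q
      · exact hsucc_path x (hNmem x hxN).1 (hNmem x hxN).2 y hyQ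
      · exact hsucc_out x (hNmem x hxN).1 (hNmem x hxN).2 y (hIU' y hy).1 hyQ
    refine Set.Pairwise.insert ?_ ?_
    · refine Set.pairwise_union.2 ⟨?_, hI, fun x hx y hy _ =>
        ⟨hSI x hx y hy, fun h => hSI x hx y hy h.symm⟩⟩
      intro x hx y hy hxy
      obtain ⟨x, hxN, rfl⟩ := Finset.mem_image.1 hx
      obtain ⟨y, hyN, rfl⟩ := Finset.mem_image.1 hy
      exact hsucc_succ x (hNmem x hxN).1 y (hNmem y hyN).1 (fun h => hxy (h ▸ rfl))
        (hNmem x hxN).2 (hNmem y hyN).2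
    · rintro x (hx | hx) -
      · exact ⟨hvS x hx, fun h => hvS x hx h.symm⟩
      · exact ⟨hvI x hx, fun h => hvI x hx h.symm⟩
  · rw [Finset.card_insert_of_notMem, Finset.card_union_of_disjoint,
      Finset.card_image_of_injective _ σ.injective]
    · omega
    · exact Finset.disjoint_left.2 fun x hx hx' => (hIU' x hx').1 (hNσ x hx)
    · rw [Finset.mem_union, not_or]
      exact ⟨fun h => hvW (hNσ v h), fun h => (hIU' v h).2 (by simp [hK])⟩
  · have hWK : Disjoint W K.toFinset := Finset.disjoint_right.2 fun x hx =>
      hWQ.disjoint x (hKsub x (List.mem_toFinset.1 hx))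
    have := hIF.union (hWQ.cycles.union hKF hWK) disjoint_compl_left
    rwa [Finset.union_comm, Finset.union_compl, zero_add] at this

end SimpleGraph

/-! ### Conclusion -/

theorem theorem1p4 {V : Type*} [Fintype V] (G : SimpleGraph V) [DecidableRel G.Adj] :
    ∃ H : SimpleGraph V, G.IsPseudoTwoFactor H ∧
      (H.numNonCycleComponents : ℤ) ≤ max 0 G.indepExcess := by
  classical
  by_cases h0 : G.HasPartialFactor Finset.univ 0
  · obtain ⟨H, hH, hn⟩ := h0.exists_isPseudoTwoFactor
    exact ⟨H, hH, le_max_of_le_left (by exact_mod_cast hn)⟩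
  · obtain ⟨n, I, v, hv, hI, hd, hF⟩ := SimpleGraph.exists_isIndepSet_degree_add_le h0
    obtain ⟨H, hH, hn⟩ := hF.exists_isPseudoTwoFactor
    refine ⟨H, hH, le_max_of_le_right ?_⟩
    have : Nonempty V := ⟨v⟩
    have h1 := G.isGreatest_indepExcess.2 ⟨I, ⟨v, hv⟩, hI, rfl⟩
    have h2 : G.minDegreeOn I ⟨v, hv⟩ ≤ G.degree v := Finset.inf'_le _ hv
    omega
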